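/- Let $-\infty\le -M<N\le\infty$, let $E=(-M,N)$ and $o\in E$, and let $a,b:E\to\mathbb R$ be functions with $a>0$ on $E$ such that $b/a$ is locally integrable on $E$. Put $C(x)=\int_o^x \frac{b}{a}\,du$ for $x\in E$, assume that $e^{C}/a$ is locally integrable on $E$, and define the measures $$\mu(dx)=\frac{e^{C(x)}}{a(x)}\,dx,\qquad \nu(dx)=e^{-C(x)}\,dx\qquad\text{on }E .$$ Let $\mathscr A_0$ be the set of absolutely continuous functions $f:E\to\mathbb R$ with compact support in $E$, let $D(f)=\int_{-M}^{N} (f')^2 e^{C}\,dx\in[0,\infty]$, and set $$\lambda^{DD}=\inf\{D(f): f\in\mathscr A_0,\ \|f\|_{L^2(\mu)}=1\}.$$ Define $\kappa^{DD}\in(0,\infty]$ by $$(\kappa^{DD})^{-1}=\inf_{x,y\in E,\ x<y}\big[\nu(-M,x)^{-1}+\nu(y,N)^{-1}\big]\,\mu(x,y)^{-1},$$ where $\mu(x,y)$, $\nu(x,y)$ denote the measures of the interval $(x,y)$, and $1/\infty=0$, $1/0=\infty$. Then $$(4\,\kappa^{DD})^{-1}\le \lambda^{DD}\le (\kappa^{DD})^{-1}.$$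 -/

import Mathlib

open MeasureTheory Set
open scoped ENNReal

namespace DiffusionDD

/-- The set of real numbers lying strictly between two extended real numbers. -/
def openIvl (l r : EReal) : Set ℝ := {x : ℝ | l < (x : EReal) ∧ (x : EReal) < r}

/-- `C(x) = ∫_o^x b/a`. -/
noncomputable def potential (a b : ℝ → ℝ) (o x : ℝ) : ℝ := ∫ u in o..x, b u / a u

/-- The measure `μ(dx) = (e^{C(x)} / a(x)) dx` on `E = (-M, N)`. -/
noncomputable def speedMeasure (M N : EReal) (a b : ℝ → ℝ) (o : ℝ) : Measure ℝ :=
  (volume.restrict (openIvl (-M) N)).withDensity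
    fun x => ENNReal.ofReal (Real.exp (potential a b o x) / a x)

/-- The measure `ν(dx) = e^{-C(x)} dx` on `E = (-M, N)`. -/
noncomputable def scaleMeasure (M N : EReal) (a b : ℝ → ℝ) (o : ℝ) : Measure ℝ :=
  (volume.restrict (openIvl (-M) N)).withDensity
    fun x => ENNReal.ofReal (Real.exp (-potential a b o x))

/-- Absolutely continuous functions with compact support in `E = (-M, N)`; such a function on `E`
is identified with its extension by zero to `ℝ`. -/
def testFunctions (M N : EReal) : Set (ℝ → ℝ) :=
  {f | (∀ s ∈ openIvl (-M) N, ∀ t ∈ openIvl (-M) N, AbsolutelyContinuousOnInterval f s t) ∧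
    HasCompactSupport f ∧ tsupport f ⊆ openIvl (-M) N}

/-- `D(f) = ∫_{-M}^N f'^2 e^C`, with values in `[0, ∞]`. -/
noncomputable def energy (M N : EReal) (a b : ℝ → ℝ) (o : ℝ) (f : ℝ → ℝ) : ℝ≥0∞ :=
  ∫⁻ x in openIvl (-M) N, ENNReal.ofReal (deriv f x ^ 2 * Real.exp (potential a b o x))

/-- The principal eigenvalue
`λ^DD = inf {D(f) : f absolutely continuous with compact support in E, ‖f‖_{L²(μ)} = 1}`. -/
noncomputable def lambdaDD (M N : EReal) (a b : ℝ → ℝ) (o : ℝ) : ℝ≥0∞ :=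
  ⨅ f ∈ {f ∈ testFunctions M N | eLpNorm f 2 (speedMeasure M N a b o) = 1}, energy M N a b o f

/-- The constant `κ^DD`, determined by
`(κ^DD)⁻¹ = inf_{x < y} [ν(-M, x)⁻¹ + ν(y, N)⁻¹] μ(x, y)⁻¹`, where `x, y` range over `E`. -/
noncomputable def kappaDD (M N : EReal) (a b : ℝ → ℝ) (o : ℝ) : ℝ≥0∞ :=
  (⨅ x ∈ openIvl (-M) N, ⨅ y ∈ openIvl (-M) N, ⨅ _ : x < y,
    ((scaleMeasure M N a b o (openIvl (-M) x))⁻¹ + (scaleMeasure M N a b o (openIvl y N))⁻¹) *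
      (speedMeasure M N a b o (openIvl x y))⁻¹)⁻¹

end DiffusionDD

/-! Lower bound. Put `σ = e^{-C}`, `F x = ν(-M, x)`, `G y = ν(y, N)`. If `J` is at most the infimum,
then `ρ = J e^C / a` satisfies `∫_x^y ρ ≤ 1/F x + 1/G y` for all `x < y`. Take `f` vanishing at the
ends of `[α, β]`, and let `c` halve the total variation of `f`. Separating the variables in the
bound on `∫_x^c ρ + ∫_c^y ρ` gives one real `d` with `∫_x^c ρ ≤ 1/F x + d` on the left of `c` and
`∫_c^y ρ ≤ 1/G y - d` on the right.

On the left, `|f|` is dominated by `H x = ∫_α^x |f'|`. Because `p = 1/F` solves `p' = -σ p²`, two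
integrations by parts and a completed square give `∫ H² ρ ≤ 4 ∫ f'² e^C + d H(c)²`
(`integral_sq_mul_le_of_tail_le`). The reflected right half gives the same with `-d`, and by the
choice of `c` the two extra terms cancel. This is `integral_sq_mul_le_four_mul`; working with both
ends at once is what keeps the constant at `4`.

Upper bound. A trapezoid that is linear in the scale `ν` on `(x₀, x)` and `(y, y₀)` and equal to `1`
on `[x, y]` has energy `1/ν(x₀, x) + 1/ν(y, y₀)` and squared norm at least `μ(x, y)`
(`lambdaDD_le_of_compact_ends`). Then `x₀` and `y₀` tend to the ends of `E`. -/

namespace DiffusionDD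

/-! ### Weighted Hardy inequalities, one-sided and two-sided. -/

/-- Integration by parts for two indefinite integrals. -/
lemma integral_parts_of_primitive {U V u v : ℝ → ℝ} {a b : ℝ} (hab : a ≤ b)
    (hu : IntervalIntegrable u volume a b) (hv : IntervalIntegrable v volume a b)
    (hU : ∀ x ∈ Icc a b, U x = U a + ∫ t in a..x, u t)
    (hV : ∀ x ∈ Icc a b, V x = V a + ∫ t in a..x, v t) :
    ∫ x in a..b, (u x * V x + U x * v x) = U b * V b - U a * V a := by
  have ac : ∀ (k : ℝ) {w : ℝ → ℝ}, IntervalIntegrable w volume a b →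
      AbsolutelyContinuousOnInterval (fun x => k + ∫ t in a..x, w t) a b := by
    intro k w hw
    have h1 : AbsolutelyContinuousOnInterval (fun _ : ℝ => k) a b :=
      (LipschitzWith.const k).lipschitzOnWith.absolutelyContinuousOnInterval
    exact h1.add (hw.absolutelyContinuousOnInterval_intervalIntegral (by simp))
  have key := (ac (U a) hu).integral_deriv_mul_eq_sub (ac (V a) hv)
  simp only [intervalIntegral.integral_same, add_zero] at key
  rw [← hU b (right_mem_Icc.2 hab), ← hV b (right_mem_Icc.2 hab)] at key
  rw [← key]
  apply intervalIntegral.integral_congr_ae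
  filter_upwards [hu.ae_hasDerivAt_integral, hv.ae_hasDerivAt_integral] with x h1 h2 hx
  have hx' := uIoc_subset_uIcc hx
  rw [uIcc_of_le hab] at hx'
  have hx'' : x ∈ uIcc a b := by rwa [uIcc_of_le hab]
  rw [((h1 hx'' a (by simp)).const_add (U a)).deriv,
    ((h2 hx'' a (by simp)).const_add (V a)).deriv, ← hU x hx', ← hV x hx']

/-- A weighted Hardy inequality on `[α, c]`, with a weight `ρ` whose tails are controlled by a
nonnegative solution `p` of `p' = -σ p²`. -/
lemma integral_sq_mul_le_of_tail_le {α c d : ℝ} (hαc : α ≤ c) {w σ e p ρ : ℝ → ℝ}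
    (hw0 : ∀ x, 0 ≤ w x) (hw : IntervalIntegrable w volume α c)
    (hσ : ContinuousOn σ (Icc α c)) (hσ0 : ∀ x ∈ Icc α c, 0 < σ x)
    (he : ∀ x ∈ Icc α c, σ x * e x = 1)
    (hwe : IntervalIntegrable (fun x => w x ^ 2 * e x) volume α c)
    (hρ : IntervalIntegrable ρ volume α c)
    (hp0 : ∀ x ∈ Icc α c, 0 ≤ p x)
    (hp : ∀ x ∈ Icc α c, HasDerivAt p (-(σ x * p x ^ 2)) x)
    (htail : ∀ r ∈ Ioo α c, ∫ x in r..c, ρ x ≤ p r + d) :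
    ∫ x in α..c, (∫ t in α..x, w t) ^ 2 * ρ x ≤
      4 * (∫ x in α..c, w x ^ 2 * e x) + d * (∫ t in α..c, w t) ^ 2 := by
  set H : ℝ → ℝ := fun x => ∫ t in α..x, w t with hH
  set P : ℝ → ℝ := fun r => ∫ x in r..c, ρ x with hP
  have sub : ∀ {f : ℝ → ℝ} {x y : ℝ}, IntervalIntegrable f volume α c → x ∈ Icc α c →
      y ∈ Icc α c → IntervalIntegrable f volume x y := by
    intro f x y hf hx hy
    refine hf.mono_set ?_
    rw [uIcc_of_le hαc]
    exact uIcc_subset_Icc hx hy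
  have lα : α ∈ Icc α c := left_mem_Icc.2 hαc
  have rc : c ∈ Icc α c := right_mem_Icc.2 hαc
  have hHα : H α = 0 := by simp [hH]
  have hHc : ContinuousOn H (uIcc α c) :=
    (hw.absolutelyContinuousOnInterval_intervalIntegral (by simp)).continuousOn
  have hH0 : ∀ x ∈ Icc α c, 0 ≤ H x := fun x hx =>
    intervalIntegral.integral_nonneg hx.1 fun t _ => hw0 t
  have hHprim : ∀ x ∈ Icc α c, H x = H α + ∫ t in α..x, w t := fun x _ => by simp [hH]
  have hHw : IntervalIntegrable (fun x => 2 * H x * w x) volume α c :=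
    hw.continuousOn_mul (hHc.const_mul 2)
  have hsq : ∀ x ∈ Icc α c, H x ^ 2 = H α ^ 2 + ∫ t in α..x, 2 * H t * w t := by
    intro x hx
    have := integral_parts_of_primitive hx.1 (sub hw lα hx) (sub hw lα hx)
      (U := H) (V := H) (fun y hy => hHprim y ⟨hy.1, hy.2.trans hx.2⟩)
      (fun y hy => hHprim y ⟨hy.1, hy.2.trans hx.2⟩)
    rw [hHα] at this ⊢
    have h2 : ∫ t in α..x, 2 * H t * w t = ∫ t in α..x, (w t * H t + H t * w t) :=
      intervalIntegral.integral_congr fun t _ => by ring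
    rw [h2, this]; ring
  have hPprim : ∀ x ∈ Icc α c, P x = P α + ∫ t in α..x, -ρ t := by
    intro x hx
    have := intervalIntegral.integral_add_adjacent_intervals (sub hρ lα hx) (sub hρ hx rc)
    simp only [hP, intervalIntegral.integral_neg]
    linarith
  have hpc : ContinuousOn p (uIcc α c) := by
    rw [uIcc_of_le hαc]
    exact fun x hx => (hp x hx).continuousAt.continuousWithinAt
  have hσc : ContinuousOn σ (uIcc α c) := by rwa [uIcc_of_le hαc]
  have hp'c : ContinuousOn (fun x => -(σ x * p x ^ 2)) (uIcc α c) := (hσc.mul (hpc.pow 2)).neg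
  have hpprim : ∀ x ∈ Icc α c, p x = p α + ∫ t in α..x, -(σ t * p t ^ 2) := by
    intro x hx
    rw [intervalIntegral.integral_eq_sub_of_hasDerivAt (f := p)]
    · ring
    · intro t ht
      rw [uIcc_of_le hx.1] at ht
      exact hp t ⟨ht.1, ht.2.trans hx.2⟩
    · exact sub hp'c.intervalIntegrable lα hx
  have hPc : ContinuousOn P (uIcc α c) := by
    have := (hρ.neg.absolutelyContinuousOnInterval_intervalIntegral (c := α) (by simp)).continuousOn
    refine (this.const_add (P α)).congr fun x hx => hPprim x ?_
    rwa [uIcc_of_le hαc] at hx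
  -- the three integrals compared
  have i1 : IntervalIntegrable (fun x => 2 * H x * w x * P x) volume α c :=
    hHw.mul_continuousOn hPc
  have i2 : IntervalIntegrable (fun x => H x ^ 2 * ρ x) volume α c :=
    hρ.continuousOn_mul (hHc.pow 2)
  have i3 : IntervalIntegrable (fun x => 2 * H x * w x * p x) volume α c :=
    hHw.mul_continuousOn hpc
  have i4 : IntervalIntegrable (fun x => H x ^ 2 * (σ x * p x ^ 2)) volume α c :=
    ((hHc.pow 2).mul (hσc.mul (hpc.pow 2))).intervalIntegrable
  have e1 := integral_parts_of_primitive hαc hHw hρ.neg (U := fun x => H x ^ 2) (V := P) hsq hPprim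
  have e2 := integral_parts_of_primitive hαc hHw hp'c.intervalIntegrable
    (U := fun x => H x ^ 2) (V := p) hsq hpprim
  -- No boundary terms: `H` vanishes at `α` and the tail `P` vanishes at `c`.
  have e1' : (∫ x in α..c, H x ^ 2 * ρ x) = ∫ x in α..c, 2 * H x * w x * P x := by
    have : ∫ x in α..c, (2 * H x * w x * P x + H x ^ 2 * (-ρ) x) =
        (∫ x in α..c, 2 * H x * w x * P x) - ∫ x in α..c, H x ^ 2 * ρ x := by
      rw [← intervalIntegral.integral_sub i1 i2]
      exact intervalIntegral.integral_congr fun x _ => by simp; ring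
    rw [this] at e1
    have hPc0 : P c = 0 := by simp [hP]
    simp only [hPc0, hHα] at e1
    linarith
  -- Here the boundary term `H(c)² p(c)` survives, but it has the favourable sign and is dropped.
  have e2' : (∫ x in α..c, H x ^ 2 * (σ x * p x ^ 2)) ≤ ∫ x in α..c, 2 * H x * w x * p x := by
    have : ∫ x in α..c, (2 * H x * w x * p x + H x ^ 2 * -(σ x * p x ^ 2)) =
        (∫ x in α..c, 2 * H x * w x * p x) - ∫ x in α..c, H x ^ 2 * (σ x * p x ^ 2) := by
      rw [← intervalIntegral.integral_sub i3 i4]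
      exact intervalIntegral.integral_congr fun x _ => by ring
    rw [this] at e2
    have := mul_nonneg (sq_nonneg (H c)) (hp0 c rc)
    simp only [hHα] at e2
    linarith
  have e3 : (∫ x in α..c, 2 * H x * w x * P x) ≤
      (∫ x in α..c, 2 * H x * w x * p x) + d * H c ^ 2 := by
    have h1 : H c ^ 2 = ∫ x in α..c, 2 * H x * w x := by rw [hsq c rc, hHα]; ring
    rw [h1, ← intervalIntegral.integral_const_mul,
      ← intervalIntegral.integral_add i3 (hHw.const_mul d)]
    refine intervalIntegral.integral_mono_on_of_le_Ioo hαc i1 (i3.add (hHw.const_mul d)) ?_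
    intro x hx
    have h2 : 0 ≤ 2 * H x * w x :=
      mul_nonneg (mul_nonneg zero_le_two (hH0 x (Ioo_subset_Icc_self hx))) (hw0 x)
    have := mul_le_mul_of_nonneg_left (htail x hx) h2
    simp only [hP]
    linarith
  -- The weights `1/2` and `2` are chosen so that, with `e2'`, the left side `X` satisfies `X ≤ X/2
  -- + 2Y`, where `Y = ∫ w² e`. Hence `X ≤ 4Y`, the origin of the constant `4`.
  have e4 : (∫ x in α..c, 2 * H x * w x * p x) ≤
      1 / 2 * (∫ x in α..c, H x ^ 2 * (σ x * p x ^ 2)) + 2 * ∫ x in α..c, w x ^ 2 * e x := by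
    rw [← intervalIntegral.integral_const_mul, ← intervalIntegral.integral_const_mul,
      ← intervalIntegral.integral_add (i4.const_mul _) (hwe.const_mul _)]
    refine intervalIntegral.integral_mono_on hαc i3 ((i4.const_mul _).add (hwe.const_mul _)) ?_
    intro x hx
    have h1 := hσ0 x hx
    have h2 : e x = (σ x)⁻¹ := eq_inv_of_mul_eq_one_right (he x hx)
    have h3 : 1 / 2 * (H x ^ 2 * (σ x * p x ^ 2)) + 2 * (w x ^ 2 * e x) - 2 * H x * w x * p x =
        (H x * σ x * p x - 2 * w x) ^ 2 / (2 * σ x) := by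
      rw [h2]; field_simp; ring
    have h4 : 0 ≤ (H x * σ x * p x - 2 * w x) ^ 2 / (2 * σ x) := by positivity
    linarith
  linarith

/-- If `F` is a (possibly infinite) primitive of `σ`, then `1 / F` solves `p' = -σ p²`. -/
lemma hasDerivAt_toReal_inv {F : ℝ → ℝ≥0∞} {σ : ℝ → ℝ} {U : Set ℝ} (hU : IsOpen U)
    (hUc : U.OrdConnected) (hσ : ContinuousOn σ U) (hF0 : ∀ x ∈ U, F x ≠ 0)
    (hσ0 : ∀ x ∈ U, 0 < σ x)
    (hF : ∀ x ∈ U, ∀ y ∈ U, x ≤ y → F y = F x + ENNReal.ofReal (∫ t in x..y, σ t))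
    {x : ℝ} (hx : x ∈ U) :
    HasDerivAt (fun s => ((F s)⁻¹).toReal) (-(σ x * ((F x)⁻¹).toReal ^ 2)) x := by
  -- An infinite value at one point forces `F = ⊤` on all of `U`; then `1 / F` is identically zero
  -- there and the equation is trivial.
  by_cases htop : F x = ⊤
  · have hev : (fun s => ((F s)⁻¹).toReal) =ᶠ[nhds x] fun _ => 0 := by
      filter_upwards [hU.mem_nhds hx] with s hs
      have : F s = ⊤ := by
        rcases le_total x s with h | h
        · rw [hF x hx s hs h, htop, top_add]
        · have := hF s hs x hx h
          rw [htop] at this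
          by_contra hne
          exact (ENNReal.add_ne_top.2 ⟨hne, ENNReal.ofReal_ne_top⟩) this.symm
      simp [this]
    simpa [htop] using (hasDerivAt_const x (0 : ℝ)).congr_of_eventuallyEq hev
  · have hint : ∀ s ∈ U, ∀ t ∈ U, IntervalIntegrable σ volume s t := fun s hs t ht =>
      (hσ.mono (hUc.uIcc_subset hs ht)).intervalIntegrable
    have hreal : ∀ s ∈ U, (F s).toReal = (F x).toReal + ∫ t in x..s, σ t := by
      intro s hs
      rcases le_total x s with h | h
      · rw [hF x hx s hs h, ENNReal.toReal_add htop ENNReal.ofReal_ne_top, ENNReal.toReal_ofReal]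
        exact intervalIntegral.integral_nonneg h fun t ht => (hσ0 t (hUc.out hx hs ht)).le
      · have h0 := hF s hs x hx h
        have hs' : F s ≠ ⊤ := by
          intro h'
          rw [h', top_add] at h0
          exact htop h0
        rw [h0, ENNReal.toReal_add hs' ENNReal.ofReal_ne_top, ENNReal.toReal_ofReal,
          intervalIntegral.integral_symm s x]
        · ring
        · exact intervalIntegral.integral_nonneg h fun t ht => (hσ0 t (hUc.out hs hx ht)).le
    have hd : HasDerivAt (fun s => (F x).toReal + ∫ t in x..s, σ t) (σ x) x := by
      refine HasDerivAt.const_add _ ?_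
      exact intervalIntegral.integral_hasDerivAt_right (hint x hx x hx)
        (hσ.stronglyMeasurableAtFilter hU x hx) (hσ.continuousAt (hU.mem_nhds hx))
    have hne : (F x).toReal ≠ 0 := ENNReal.toReal_ne_zero.2 ⟨hF0 x hx, htop⟩
    have hd2 := (hd.inv (by simpa using hne)).congr_of_eventuallyEq
      (f₁ := fun s => ((F s)⁻¹).toReal) (by
        filter_upwards [hU.mem_nhds hx] with s hs
        rw [ENNReal.toReal_inv, hreal s hs]; rfl)
    refine hd2.congr_deriv ?_
    rw [ENNReal.toReal_inv, intervalIntegral.integral_same, add_zero, inv_pow, neg_div,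
      div_eq_mul_inv]

/-- The two-sided weighted Hardy inequality with constant `4`. -/
lemma integral_sq_mul_le_four_mul {U : Set ℝ} (hU : IsOpen U) (hUc : U.OrdConnected)
    {σ e ρ : ℝ → ℝ} {F G : ℝ → ℝ≥0∞}
    (hσ : ContinuousOn σ U) (hσ0 : ∀ x ∈ U, 0 < σ x) (he : ∀ x ∈ U, σ x * e x = 1)
    (hρ0 : ∀ x ∈ U, 0 ≤ ρ x) (hF0 : ∀ x ∈ U, F x ≠ 0) (hG0 : ∀ x ∈ U, G x ≠ 0)
    (hF : ∀ x ∈ U, ∀ y ∈ U, x ≤ y → F y = F x + ENNReal.ofReal (∫ t in x..y, σ t))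
    (hG : ∀ x ∈ U, ∀ y ∈ U, x ≤ y → G x = G y + ENNReal.ofReal (∫ t in x..y, σ t))
    {α β : ℝ} (hα : α ∈ U) (hβ : β ∈ U) (hαβ : α < β)
    (hJ : ∀ x ∈ U, ∀ y ∈ U, x < y →
      ∫ t in x..y, ρ t ≤ ((F x)⁻¹).toReal + ((G y)⁻¹).toReal)
    (hJi : ∀ x ∈ U, ∀ y ∈ U, IntervalIntegrable ρ volume x y)
    {f : ℝ → ℝ} (hf : AbsolutelyContinuousOnInterval f α β) (hfα : f α = 0) (hfβ : f β = 0)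
    (hfe : IntervalIntegrable (fun x => deriv f x ^ 2 * e x) volume α β) :
    ∫ x in α..β, f x ^ 2 * ρ x ≤ 4 * ∫ x in α..β, deriv f x ^ 2 * e x := by
  set w : ℝ → ℝ := fun x => |deriv f x| with hw_def
  have hsub : Icc α β ⊆ U := hUc.out hα hβ
  have hρ : IntervalIntegrable ρ volume α β := hJi α hα β hβ
  have hf' := hf.intervalIntegrable_deriv
  have hw : IntervalIntegrable w volume α β := hf'.abs
  have hw0 : ∀ x, 0 ≤ w x := fun x => abs_nonneg _
  have lα : α ∈ Icc α β := left_mem_Icc.2 hαβ.le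
  have rβ : β ∈ Icc α β := right_mem_Icc.2 hαβ.le
  have sub : ∀ {g : ℝ → ℝ} {x y : ℝ}, IntervalIntegrable g volume α β → x ∈ Icc α β →
      y ∈ Icc α β → IntervalIntegrable g volume x y := by
    intro g x y hg hx hy
    refine hg.mono_set ?_
    rw [uIcc_of_le hαβ.le]
    exact uIcc_subset_Icc hx hy
  have hwe : IntervalIntegrable (fun x => w x ^ 2 * e x) volume α β := by
    simpa only [hw_def, sq_abs] using hfe
  have hfρ : IntervalIntegrable (fun x => f x ^ 2 * ρ x) volume α β :=
    hρ.continuousOn_mul (hf.continuousOn.pow 2)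
  -- pointwise bounds on `f`
  have hleft : ∀ x ∈ Icc α β, |f x| ≤ ∫ t in α..x, w t := by
    intro x hx
    have h1 := (hf.mono (c := α) (d := x) (by
      rw [uIcc_of_le hαβ.le]; exact uIcc_subset_Icc lα hx)).integral_deriv_eq_sub
    rw [hfα, sub_zero] at h1
    rw [← h1]
    exact intervalIntegral.abs_integral_le_integral_abs hx.1
  have hright : ∀ x ∈ Icc α β, |f x| ≤ ∫ t in x..β, w t := by
    intro x hx
    have h1 := (hf.mono (c := x) (d := β) (by
      rw [uIcc_of_le hαβ.le]; exact uIcc_subset_Icc hx rβ)).integral_deriv_eq_sub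
    rw [hfβ, zero_sub] at h1
    rw [← abs_neg, ← h1]
    exact intervalIntegral.abs_integral_le_integral_abs hx.2
  -- the point dividing the total variation in two equal halves
  obtain ⟨c, hc, hcc⟩ : ∃ c ∈ Ioo α β, ∫ t in α..c, w t = ∫ t in c..β, w t := by
    have hcont : ContinuousOn (fun x => ∫ t in α..x, w t) (Icc α β) := by
      rw [← uIcc_of_le hαβ.le]
      exact (hw.absolutelyContinuousOnInterval_intervalIntegral (by simp)).continuousOn
    have hadd : ∀ x ∈ Icc α β, (∫ t in α..x, w t) + ∫ t in x..β, w t = ∫ t in α..β, w t :=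
      fun x hx => intervalIntegral.integral_add_adjacent_intervals (sub hw lα hx) (sub hw hx rβ)
    have hT : 0 ≤ ∫ t in α..β, w t := intervalIntegral.integral_nonneg hαβ.le fun t _ => hw0 t
    -- With zero variation any interior point does. It must be interior so that both index sets in
    -- the choice of `d` are nonempty.
    rcases hT.eq_or_lt with hT | hT
    · refine ⟨(α + β) / 2, ⟨by linarith, by linarith⟩, ?_⟩
      have hm : (α + β) / 2 ∈ Icc α β := ⟨by linarith, by linarith⟩
      have h1 := hadd _ hm
      have h2 : 0 ≤ ∫ t in α..(α + β) / 2, w t :=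
        intervalIntegral.integral_nonneg hm.1 fun t _ => hw0 t
      have h3 : 0 ≤ ∫ t in (α + β) / 2..β, w t :=
        intervalIntegral.integral_nonneg hm.2 fun t _ => hw0 t
      linarith
    · obtain ⟨c, hc, h⟩ := intermediate_value_Ioo hαβ.le hcont
        (show (∫ t in α..β, w t) / 2 ∈ Ioo _ _ from ⟨by simpa using hT, by linarith⟩)
      refine ⟨c, hc, ?_⟩
      have h1 := hadd c (Ioo_subset_Icc_self hc)
      simp only at h
      linarith
  have hcm : c ∈ Icc α β := Ioo_subset_Icc_self hc
  have hcU : c ∈ U := hsub hcm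
  -- the constant exchanged between the two sides
  obtain ⟨d, hd1, hd2⟩ : ∃ d, (∀ x ∈ Ioo α c, (∫ t in x..c, ρ t) - ((F x)⁻¹).toReal ≤ d) ∧
      ∀ y ∈ Ioo c β, d ≤ ((G y)⁻¹).toReal - ∫ t in c..y, ρ t := by
    -- `hJ`, split at `c`, puts every element of the first set below every element of the second.
    obtain ⟨d, h1, h2⟩ := exists_between_of_forall_le
      (s := (fun x => (∫ t in x..c, ρ t) - ((F x)⁻¹).toReal) '' Ioo α c)
      (t := (fun y => ((G y)⁻¹).toReal - ∫ t in c..y, ρ t) '' Ioo c β)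
      ((nonempty_Ioo.2 hc.1).image _) ((nonempty_Ioo.2 hc.2).image _) (by
        rintro _ ⟨x, hx, rfl⟩ _ ⟨y, hy, rfl⟩
        have hxU : x ∈ U := hsub ⟨hx.1.le, (hx.2.trans hc.2).le⟩
        have hyU : y ∈ U := hsub ⟨(hc.1.trans hy.1).le, hy.2.le⟩
        have h1 := hJ x hxU y hyU (hx.2.trans hy.1)
        have h2 := intervalIntegral.integral_add_adjacent_intervals
          (hJi x hxU c hcU) (hJi c hcU y hyU)
        simp only
        linarith)
    exact ⟨d, fun x hx => h1 ⟨x, hx, rfl⟩, fun y hy => h2 ⟨y, hy, rfl⟩⟩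
  -- the left half
  have hsubl : Icc α c ⊆ U := fun x hx => hsub ⟨hx.1, hx.2.trans hc.2.le⟩
  have hL : ∫ x in α..c, f x ^ 2 * ρ x ≤
      4 * (∫ x in α..c, w x ^ 2 * e x) + d * (∫ t in α..c, w t) ^ 2 := by
    refine le_trans ?_ (integral_sq_mul_le_of_tail_le (p := fun s => ((F s)⁻¹).toReal)
      hc.1.le hw0 (sub hw lα hcm) (hσ.mono hsubl) (fun x hx => hσ0 x (hsubl hx))
      (fun x hx => he x (hsubl hx)) (sub hwe lα hcm) (sub hρ lα hcm)
      (fun x _ => ENNReal.toReal_nonneg)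
      (fun x hx => hasDerivAt_toReal_inv hU hUc hσ hF0 hσ0 hF (hsubl hx))
      (fun r hr => by linarith [hd1 r hr]))
    refine intervalIntegral.integral_mono_on hc.1.le (sub hfρ lα hcm) ?_ ?_
    · refine (sub hρ lα hcm).continuousOn_mul (ContinuousOn.pow ?_ 2)
      exact ((sub hw lα hcm).absolutelyContinuousOnInterval_intervalIntegral
        (by simp)).continuousOn
    · intro x hx
      have := hleft x ⟨hx.1, hx.2.trans hc.2.le⟩
      refine mul_le_mul_of_nonneg_right ?_ (hρ0 x (hsubl hx))
      rw [← sq_abs]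
      exact pow_le_pow_left₀ (abs_nonneg _) this 2
  -- the right half, by reflection
  have hsubr : ∀ x ∈ Icc (-β) (-c), -x ∈ U := fun x hx =>
    hsub ⟨by linarith [hx.2, hc.1], by linarith [hx.1]⟩
  have refl_int : ∀ {g : ℝ → ℝ}, IntervalIntegrable g volume α β →
      IntervalIntegrable (fun x => g (-x)) volume (-β) (-c) := by
    intro g hg
    exact ((IntervalIntegrable.iff_comp_neg (by simp)).1 (sub hg hcm rβ)).symm
  have hR : ∫ x in c..β, f x ^ 2 * ρ x ≤
      4 * (∫ x in c..β, w x ^ 2 * e x) + -d * (∫ t in c..β, w t) ^ 2 := by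
    have hUn : IsOpen (-U) := hU.neg
    have hUnc : (-U).OrdConnected := by
      refine ⟨fun x hx y hy z hz => ?_⟩
      exact hUc.out hy hx ⟨neg_le_neg hz.2, neg_le_neg hz.1⟩
    have hderiv : ∀ x ∈ Icc (-β) (-c), HasDerivAt (fun s => ((G (-s))⁻¹).toReal)
        (-(σ (-x) * ((G (-x))⁻¹).toReal ^ 2)) x := by
      intro x hx
      refine hasDerivAt_toReal_inv (F := fun s => G (-s)) (σ := fun s => σ (-s)) hUn hUnc
        (hσ.comp continuousOn_neg fun s hs => hs) (fun s hs => hG0 _ hs) (fun s hs => hσ0 _ hs)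
        ?_ (hsubr x hx)
      -- Reflection turns the decreasing `G` into an increasing primitive of the reflected `σ`.
      intro s hs t ht hst
      rw [intervalIntegral.integral_comp_neg]
      exact hG (-t) ht (-s) hs (neg_le_neg hst)
    have key := integral_sq_mul_le_of_tail_le (α := -β) (c := -c) (d := -d)
      (w := fun x => w (-x)) (σ := fun x => σ (-x)) (e := fun x => e (-x))
      (ρ := fun x => ρ (-x)) (p := fun s => ((G (-s))⁻¹).toReal) (neg_le_neg hc.2.le)
      (fun x => hw0 _) (refl_int hw)
      (hσ.comp continuousOn_neg fun s hs => hsubr s hs)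
      (fun x hx => hσ0 _ (hsubr x hx)) (fun x hx => he _ (hsubr x hx))
      (refl_int hwe) (refl_int hρ) (fun x _ => ENNReal.toReal_nonneg) hderiv
      (fun r hr => by
        rw [intervalIntegral.integral_comp_neg, neg_neg]
        linarith [hd2 (-r) ⟨by linarith [hr.2], by linarith [hr.1]⟩])
    simp only [intervalIntegral.integral_comp_neg, neg_neg,
      intervalIntegral.integral_comp_neg (fun x => w x ^ 2 * e x)] at key
    rw [intervalIntegral.integral_comp_neg
      (fun x => (∫ t in x..β, w t) ^ 2 * ρ x), neg_neg, neg_neg] at key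
    refine le_trans ?_ key
    refine intervalIntegral.integral_mono_on hc.2.le (sub hfρ hcm rβ) ?_ ?_
    · refine (sub hρ hcm rβ).continuousOn_mul (ContinuousOn.pow ?_ 2)
      have h1 := ((sub hw hcm rβ).symm.absolutelyContinuousOnInterval_intervalIntegral
        (c := β) (by simp)).continuousOn.neg
      rw [uIcc_comm] at h1
      refine h1.congr fun x _ => ?_
      exact intervalIntegral.integral_symm _ _
    · intro x hx
      have hxI : x ∈ Icc α β := ⟨hc.1.le.trans hx.1, hx.2⟩
      have := hright x hxI
      refine mul_le_mul_of_nonneg_right ?_ (hρ0 x (hsub hxI))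
      rw [← sq_abs]
      exact pow_le_pow_left₀ (abs_nonneg _) this 2
  have s1 := intervalIntegral.integral_add_adjacent_intervals
    (sub hfρ lα hcm) (sub hfρ hcm rβ)
  have s2 := intervalIntegral.integral_add_adjacent_intervals
    (sub hwe lα hcm) (sub hwe hcm rβ)
  have s3 : ∫ x in α..β, deriv f x ^ 2 * e x = ∫ x in α..β, w x ^ 2 * e x := by
    simp only [hw_def, sq_abs]
  rw [s3, ← s1, ← s2]
  -- Since `c` halves the variation, the terms with `d` and `-d` carry the same square and cancel in
  -- the sum.
  rw [← hcc] at hR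
  linarith

/-! ### Intervals with extended real endpoints and measures with locally integrable density. -/

lemma isOpen_openIvl (l r : EReal) : IsOpen (openIvl l r) :=
  isOpen_Ioo.preimage continuous_coe_real_ereal

lemma ordConnected_openIvl (l r : EReal) : (openIvl l r).OrdConnected :=
  ⟨fun _ hx _ hy _ hz => ⟨hx.1.trans_le (EReal.coe_le_coe_iff.2 hz.1),
    (EReal.coe_le_coe_iff.2 hz.2).trans_lt hy.2⟩⟩

lemma measurableSet_openIvl (l r : EReal) : MeasurableSet (openIvl l r) :=
  (isOpen_openIvl l r).measurableSet

lemma openIvl_coe (x y : ℝ) : openIvl (x : EReal) (y : EReal) = Ioo x y := by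
  ext z; simp [openIvl]

lemma exists_lt_mem_of_isOpen {U : Set ℝ} (hU : IsOpen U) {x : ℝ} (hx : x ∈ U) :
    ∃ s ∈ U, s < x := by
  obtain ⟨l, u, hlu, h⟩ := mem_nhds_iff_exists_Ioo_subset.1 (hU.mem_nhds hx)
  obtain ⟨s, hs⟩ := exists_between hlu.1
  exact ⟨s, h ⟨hs.1, hs.2.trans hlu.2⟩, hs.2⟩

lemma exists_gt_mem_of_isOpen {U : Set ℝ} (hU : IsOpen U) {x : ℝ} (hx : x ∈ U) :
    ∃ s ∈ U, x < s := by
  obtain ⟨l, u, hlu, h⟩ := mem_nhds_iff_exists_Ioo_subset.1 (hU.mem_nhds hx)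
  obtain ⟨s, hs⟩ := exists_between hlu.2
  exact ⟨s, h ⟨hlu.1.trans hs.1, hs.2⟩, hs.1⟩

lemma intervalIntegrable_of_locallyIntegrableOn {U : Set ℝ} (hUc : U.OrdConnected)
    {g : ℝ → ℝ} (hg : LocallyIntegrableOn g U volume) {x y : ℝ} (hx : x ∈ U) (hy : y ∈ U) :
    IntervalIntegrable g volume x y := by
  rw [intervalIntegrable_iff']
  exact hg.integrableOn_compact_subset (hUc.uIcc_subset hx hy) isCompact_uIcc

lemma continuousOn_integral_of_locallyIntegrableOn {U : Set ℝ} (hU : IsOpen U)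
    (hUc : U.OrdConnected) {g : ℝ → ℝ} (hg : LocallyIntegrableOn g U volume) {o : ℝ}
    (ho : o ∈ U) : ContinuousOn (fun x => ∫ t in o..x, g t) U := by
  intro x hx
  obtain ⟨s, hs, hsx⟩ : ∃ s ∈ U, s < min x o :=
    exists_lt_mem_of_isOpen hU (by rcases min_choice x o with h | h <;> rwa [h])
  obtain ⟨t, ht, hxt⟩ : ∃ t ∈ U, max x o < t :=
    exists_gt_mem_of_isOpen hU (by rcases max_choice x o with h | h <;> rwa [h])
  rw [lt_min_iff] at hsx
  rw [max_lt_iff] at hxt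
  have hc := ((intervalIntegrable_of_locallyIntegrableOn hUc hg hs ht)
    |>.absolutelyContinuousOnInterval_intervalIntegral (c := o)
      (by rw [uIcc_of_le (hsx.1.trans hxt.1).le]; exact ⟨hsx.2.le, hxt.2.le⟩)).continuousOn
  rw [uIcc_of_le (hsx.1.trans hxt.1).le] at hc
  exact (hc.continuousAt (Icc_mem_nhds hsx.1 hxt.1)).continuousWithinAt

/-- The measure with density `g` on `U`, evaluated on an interval with endpoints in `U`. -/
lemma withDensity_restrict_apply_of_ae_eq {U A : Set ℝ} (hUc : U.OrdConnected)
    {g : ℝ → ℝ} (hg : LocallyIntegrableOn g U volume) (hg0 : ∀ x ∈ U, 0 ≤ g x)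
    {x y : ℝ} (hx : x ∈ U) (hy : y ∈ U) (hxy : x ≤ y) (hA : MeasurableSet A)
    (hAU : A ⊆ U) (hAe : A =ᵐ[volume] Ioc x y) :
    ((volume.restrict U).withDensity fun t => ENNReal.ofReal (g t)) A =
      ENNReal.ofReal (∫ t in x..y, g t) := by
  have hi := intervalIntegrable_of_locallyIntegrableOn hUc hg hx hy
  rw [withDensity_apply _ hA, Measure.restrict_restrict hA, inter_eq_left.2 hAU,
    setLIntegral_congr hAe, intervalIntegral.integral_of_le hxy, ofReal_integral_eq_lintegral_ofReal
      ((intervalIntegrable_iff_integrableOn_Ioc_of_le hxy).1 hi)]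
  refine (ae_restrict_iff' measurableSet_Ioc).2 (Filter.Eventually.of_forall fun t ht => ?_)
  exact hg0 t (hUc.out hx hy (Ioc_subset_Icc_self ht))

lemma withDensity_restrict_Ioo {U : Set ℝ} (hUc : U.OrdConnected)
    {g : ℝ → ℝ} (hg : LocallyIntegrableOn g U volume) (hg0 : ∀ x ∈ U, 0 ≤ g x)
    {x y : ℝ} (hx : x ∈ U) (hy : y ∈ U) (hxy : x ≤ y) :
    ((volume.restrict U).withDensity fun t => ENNReal.ofReal (g t)) (Ioo x y) =
      ENNReal.ofReal (∫ t in x..y, g t) :=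
  withDensity_restrict_apply_of_ae_eq hUc hg hg0 hx hy hxy measurableSet_Ioo
    (Ioo_subset_Icc_self.trans (hUc.out hx hy)) Ioo_ae_eq_Ioc

/-- Additivity is kept in `[0, ∞]` because the mass near the end may be infinite. This is the form
of "primitive" that `hasDerivAt_toReal_inv` accepts. -/
lemma withDensity_openIvl_left {l r : EReal} {g : ℝ → ℝ}
    (hg : LocallyIntegrableOn g (openIvl l r) volume) (hg0 : ∀ x ∈ openIvl l r, 0 ≤ g x)
    {x y : ℝ} (hx : x ∈ openIvl l r) (hy : y ∈ openIvl l r) (hxy : x ≤ y) :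
    ((volume.restrict (openIvl l r)).withDensity fun t => ENNReal.ofReal (g t)) (openIvl l y) =
      ((volume.restrict (openIvl l r)).withDensity fun t => ENNReal.ofReal (g t)) (openIvl l x) +
        ENNReal.ofReal (∫ t in x..y, g t) := by
  have hU := ordConnected_openIvl l r
  rw [← withDensity_restrict_apply_of_ae_eq hU hg hg0 hx hy hxy measurableSet_Ico
    (Ico_subset_Icc_self.trans (hU.out hx hy)) Ico_ae_eq_Ioc,
    ← measure_union _ measurableSet_Ico]
  · congr 1
    ext z
    simp only [openIvl, mem_union, mem_ofPred_eq, mem_Ico, EReal.coe_lt_coe_iff]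
    constructor
    · rintro ⟨h1, h2⟩
      rcases lt_or_ge z x with h | h
      · exact Or.inl ⟨h1, h⟩
      · exact Or.inr ⟨h, h2⟩
    · rintro (⟨h1, h2⟩ | ⟨h1, h2⟩)
      · exact ⟨h1, h2.trans_le hxy⟩
      · exact ⟨hx.1.trans_le (EReal.coe_le_coe_iff.2 h1), h2⟩
  · refine disjoint_left.2 fun z hz hz' => ?_
    exact absurd hz'.1 (not_le.2 (EReal.coe_lt_coe_iff.1 hz.2))

lemma withDensity_openIvl_right {l r : EReal} {g : ℝ → ℝ}
    (hg : LocallyIntegrableOn g (openIvl l r) volume) (hg0 : ∀ x ∈ openIvl l r, 0 ≤ g x)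
    {x y : ℝ} (hx : x ∈ openIvl l r) (hy : y ∈ openIvl l r) (hxy : x ≤ y) :
    ((volume.restrict (openIvl l r)).withDensity fun t => ENNReal.ofReal (g t)) (openIvl x r) =
      ((volume.restrict (openIvl l r)).withDensity fun t => ENNReal.ofReal (g t)) (openIvl y r) +
        ENNReal.ofReal (∫ t in x..y, g t) := by
  have hU := ordConnected_openIvl l r
  rw [← withDensity_restrict_apply_of_ae_eq hU hg hg0 hx hy hxy measurableSet_Ioc
    (Ioc_subset_Icc_self.trans (hU.out hx hy)) Filter.EventuallyEq.rfl,
    ← measure_union _ measurableSet_Ioc]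
  · congr 1
    ext z
    simp only [openIvl, mem_union, mem_ofPred_eq, mem_Ioc, EReal.coe_lt_coe_iff]
    constructor
    · rintro ⟨h1, h2⟩
      rcases lt_or_ge y z with h | h
      · exact Or.inl ⟨h, h2⟩
      · exact Or.inr ⟨h1, h⟩
    · rintro (⟨h1, h2⟩ | ⟨h1, h2⟩)
      · exact ⟨hxy.trans_lt h1, h2⟩
      · exact ⟨h1, (EReal.coe_le_coe_iff.2 h2).trans_lt hy.2⟩
  · refine disjoint_left.2 fun z hz hz' => ?_
    exact absurd hz'.2 (not_le.2 (EReal.coe_lt_coe_iff.1 hz.1))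

lemma integral_pos_of_locallyIntegrableOn {U : Set ℝ} (hUc : U.OrdConnected)
    {g : ℝ → ℝ} (hg : LocallyIntegrableOn g U volume) (hg0 : ∀ x ∈ U, 0 < g x)
    {x y : ℝ} (hx : x ∈ U) (hy : y ∈ U) (hxy : x < y) : 0 < ∫ t in x..y, g t :=
  intervalIntegral.intervalIntegral_pos_of_pos_on
    (intervalIntegrable_of_locallyIntegrableOn hUc hg hx hy)
    (fun t ht => hg0 t (hUc.out hx hy (Ioo_subset_Icc_self ht))) hxy

/-- Guarantees that `1 / ν(-M, x)` is finite, so passing to real values loses nothing. -/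
lemma withDensity_openIvl_left_ne_zero {l r : EReal} {g : ℝ → ℝ}
    (hg : LocallyIntegrableOn g (openIvl l r) volume) (hg0 : ∀ x ∈ openIvl l r, 0 < g x)
    {x : ℝ} (hx : x ∈ openIvl l r) :
    ((volume.restrict (openIvl l r)).withDensity fun t => ENNReal.ofReal (g t))
      (openIvl l x) ≠ 0 := by
  obtain ⟨s, hs, hsx⟩ := exists_lt_mem_of_isOpen (isOpen_openIvl l r) hx
  rw [withDensity_openIvl_left hg (fun t ht => (hg0 t ht).le) hs hx hsx.le]
  have := integral_pos_of_locallyIntegrableOn (ordConnected_openIvl l r) hg hg0 hs hx hsx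
  simp [this]

lemma withDensity_openIvl_right_ne_zero {l r : EReal} {g : ℝ → ℝ}
    (hg : LocallyIntegrableOn g (openIvl l r) volume) (hg0 : ∀ x ∈ openIvl l r, 0 < g x)
    {x : ℝ} (hx : x ∈ openIvl l r) :
    ((volume.restrict (openIvl l r)).withDensity fun t => ENNReal.ofReal (g t))
      (openIvl x r) ≠ 0 := by
  obtain ⟨s, hs, hsx⟩ := exists_gt_mem_of_isOpen (isOpen_openIvl l r) hx
  rw [withDensity_openIvl_right hg (fun t ht => (hg0 t ht).le) hx hs hsx.le]
  have := integral_pos_of_locallyIntegrableOn (ordConnected_openIvl l r) hg hg0 hx hs hsx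
  simp [this]

/-- A compact subset of an interval is contained in an open interval with endpoints in it. -/
lemma exists_Ioo_of_isCompact_subset {U K : Set ℝ} (hU : IsOpen U) (hK : IsCompact K)
    (hKU : K ⊆ U) {o : ℝ} (ho : o ∈ U) : ∃ α ∈ U, ∃ β ∈ U, α < o ∧ o < β ∧ K ⊆ Ioo α β := by
  -- `K` may be empty; adding `o` provides least and greatest elements, and places `o` strictly
  -- between the endpoints.
  have hK' : IsCompact (insert o K) := hK.insert o
  have hne : (insert o K).Nonempty := ⟨o, mem_insert _ _⟩
  have hsub : insert o K ⊆ U := insert_subset ho hKU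
  obtain ⟨m, hm, hmin⟩ := hK'.exists_isLeast hne
  obtain ⟨n, hn, hmax⟩ := hK'.exists_isGreatest hne
  obtain ⟨α, hα, hαm⟩ := exists_lt_mem_of_isOpen hU (hsub hm)
  obtain ⟨β, hβ, hnβ⟩ := exists_gt_mem_of_isOpen hU (hsub hn)
  exact ⟨α, hα, β, hβ, hαm.trans_le (hmin (mem_insert _ _)),
    (hmax (mem_insert _ _)).trans_lt hnβ, fun z hz =>
    ⟨hαm.trans_le (hmin (mem_insert_of_mem _ hz)), (hmax (mem_insert_of_mem _ hz)).trans_lt hnβ⟩⟩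

/-- The squared `L²` norm of a function supported in `[α, β]`, as an interval integral. -/
lemma eLpNorm_two_sq_withDensity {U : Set ℝ} (hUc : U.OrdConnected)
    {g : ℝ → ℝ} (hg : LocallyIntegrableOn g U volume) (hg0 : ∀ x ∈ U, 0 ≤ g x)
    {f : ℝ → ℝ} {α β : ℝ} (hα : α ∈ U) (hβ : β ∈ U) (hαβ : α ≤ β)
    (hf : ContinuousOn f (Icc α β)) (hf0 : ∀ x ∉ Ioc α β, f x = 0) :
    eLpNorm f 2 ((volume.restrict U).withDensity fun t => ENNReal.ofReal (g t)) ^ 2 =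
      ENNReal.ofReal (∫ x in α..β, f x ^ 2 * g x) := by
  have hi : IntervalIntegrable (fun x => f x ^ 2 * g x) volume α β :=
    (intervalIntegrable_of_locallyIntegrableOn hUc hg hα hβ).continuousOn_mul
      (by rw [uIcc_of_le hαβ]; exact hf.pow 2)
  have hI : Ioc α β ⊆ U := Ioc_subset_Icc_self.trans (hUc.out hα hβ)
  have hgm : AEMeasurable (fun t => ENNReal.ofReal (g t)) (volume.restrict U) :=
    hg.aestronglyMeasurable.aemeasurable.ennreal_ofReal
  rw [intervalIntegral.integral_of_le hαβ, ofReal_integral_eq_lintegral_ofReal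
      ((intervalIntegrable_iff_integrableOn_Ioc_of_le hαβ).1 hi)
      ((ae_restrict_iff' measurableSet_Ioc).2 (Filter.Eventually.of_forall fun t ht =>
        mul_nonneg (sq_nonneg _) (hg0 t (hI ht)))),
    eLpNorm_eq_lintegral_rpow_enorm_toReal (by simp) (by simp), ← ENNReal.rpow_natCast,
    ← ENNReal.rpow_mul]
  have hfi : (fun x => ‖f x‖ₑ ^ ENNReal.toReal 2) = (Ioc α β).indicator fun x => ‖f x‖ₑ ^ 2 := by
    ext x
    by_cases hx : x ∈ Ioc α β
    · simp [hx]
    · simp [hx, hf0 x hx]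
  rw [hfi, lintegral_indicator measurableSet_Ioc, restrict_withDensity measurableSet_Ioc,
    Measure.restrict_restrict measurableSet_Ioc, inter_eq_left.2 hI]
  have hfm : AEMeasurable (fun x => ‖f x‖ₑ ^ 2) (volume.restrict (Ioc α β)) :=
    ((hf.mono Ioc_subset_Icc_self).aemeasurable measurableSet_Ioc).enorm.pow_const 2
  rw [lintegral_withDensity_eq_lintegral_mul₀ (hgm.mono_measure (Measure.restrict_mono hI le_rfl))
    hfm]
  have h1 : 1 / ENNReal.toReal 2 * ((2 : ℕ) : ℝ) = 1 := by norm_num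
  rw [h1, ENNReal.rpow_one]
  refine setLIntegral_congr_fun measurableSet_Ioc fun x hx => ?_
  rw [Pi.mul_apply, mul_comm, ENNReal.ofReal_mul (sq_nonneg _), ← ofReal_norm,
    ← ENNReal.ofReal_pow (norm_nonneg _), Real.norm_eq_abs, sq_abs]

/-! ### Lower bound for the eigenvalue. -/

section Bounds

variable {M N : EReal} {a b : ℝ → ℝ} {o : ℝ}

lemma continuousOn_potential (ho : o ∈ openIvl (-M) N)
    (hb : LocallyIntegrableOn (fun x => b x / a x) (openIvl (-M) N) volume) :
    ContinuousOn (potential a b o) (openIvl (-M) N) :=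
  continuousOn_integral_of_locallyIntegrableOn (isOpen_openIvl _ _) (ordConnected_openIvl _ _)
    hb ho

lemma continuousOn_exp_potential (ho : o ∈ openIvl (-M) N)
    (hb : LocallyIntegrableOn (fun x => b x / a x) (openIvl (-M) N) volume) :
    ContinuousOn (fun x => Real.exp (potential a b o x)) (openIvl (-M) N) :=
  (continuousOn_potential ho hb).rexp

lemma continuousOn_exp_neg_potential (ho : o ∈ openIvl (-M) N)
    (hb : LocallyIntegrableOn (fun x => b x / a x) (openIvl (-M) N) volume) :
    ContinuousOn (fun x => Real.exp (-potential a b o x)) (openIvl (-M) N) :=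
  (continuousOn_potential ho hb).neg.rexp

/-- The energy of a function supported in `[α, β]`, as an interval integral. -/
lemma energy_eq_ofReal_integral {f : ℝ → ℝ} {α β : ℝ} (hα : α ∈ openIvl (-M) N)
    (hβ : β ∈ openIvl (-M) N) (hαβ : α ≤ β) (hf0 : ∀ x ∉ Ioc α β, deriv f x = 0)
    (hi : IntervalIntegrable (fun x => deriv f x ^ 2 * Real.exp (potential a b o x))
      volume α β) :
    energy M N a b o f =
      ENNReal.ofReal (∫ x in α..β, deriv f x ^ 2 * Real.exp (potential a b o x)) := by
  have hI : Ioc α β ⊆ openIvl (-M) N :=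
    Ioc_subset_Icc_self.trans ((ordConnected_openIvl _ _).out hα hβ)
  rw [intervalIntegral.integral_of_le hαβ, ofReal_integral_eq_lintegral_ofReal
      ((intervalIntegrable_iff_integrableOn_Ioc_of_le hαβ).1 hi)
      (Filter.Eventually.of_forall fun t => by positivity), energy,
    ← inter_eq_left.2 hI, ← setLIntegral_indicator measurableSet_Ioc]
  refine lintegral_congr fun x => ?_
  by_cases hx : x ∈ Ioc α β
  · simp [hx]
  · simp [hx, hf0 x hx]

/-- The two-sided Hardy inequality is applied with `ρ = J e^C / a`; the normalisation of `f` turns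
its left side into `J`. -/
lemma le_four_mul_energy (ho : o ∈ openIvl (-M) N)
    (ha : ∀ x ∈ openIvl (-M) N, 0 < a x)
    (hb : LocallyIntegrableOn (fun x => b x / a x) (openIvl (-M) N) volume)
    (hm : LocallyIntegrableOn (fun x => Real.exp (potential a b o x) / a x)
      (openIvl (-M) N) volume) {f : ℝ → ℝ} (hf : f ∈ testFunctions M N)
    (hf1 : eLpNorm f 2 (speedMeasure M N a b o) = 1) {J : ℝ≥0∞} (hJt : J ≠ ⊤)
    (hJ : ∀ x ∈ openIvl (-M) N, ∀ y ∈ openIvl (-M) N, x < y →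
      J ≤ ((scaleMeasure M N a b o (openIvl (-M) x))⁻¹ +
        (scaleMeasure M N a b o (openIvl y N))⁻¹) *
          (speedMeasure M N a b o (openIvl x y))⁻¹) :
    J ≤ 4 * energy M N a b o f := by
  obtain ⟨hfac, hfc, hfs⟩ := hf
  have hU := isOpen_openIvl (-M) N
  have hUc := ordConnected_openIvl (-M) N
  have hσc := continuousOn_exp_neg_potential ho hb
  have hec := continuousOn_exp_potential ho hb
  have hσl : LocallyIntegrableOn (fun x => Real.exp (-potential a b o x)) (openIvl (-M) N)
      volume := hσc.locallyIntegrableOn (measurableSet_openIvl _ _)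
  have hσ0 : ∀ x ∈ openIvl (-M) N, 0 < Real.exp (-potential a b o x) :=
    fun x _ => Real.exp_pos _
  have hm0 : ∀ x ∈ openIvl (-M) N, 0 < Real.exp (potential a b o x) / a x :=
    fun x hx => div_pos (Real.exp_pos _) (ha x hx)
  -- Infinite energy is trivial; finite energy supplies the integrability of `f'² e^C`.
  by_cases hD : energy M N a b o f = ⊤
  · rw [hD]; simp
  obtain ⟨α, hα, β, hβ, hαo, hoβ, hK⟩ := exists_Ioo_of_isCompact_subset hU hfc.isCompact hfs ho
  have hαβ : α < β := hαo.trans hoβ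
  have hsub : Icc α β ⊆ openIvl (-M) N := hUc.out hα hβ
  have hf0 : ∀ x ∉ Ioo α β, f x = 0 := fun x hx =>
    image_eq_zero_of_notMem_tsupport fun h => hx (hK h)
  have hf0' : ∀ x ∉ Ioc α β, deriv f x = 0 := fun x hx => by
    by_contra h
    exact hx (Ioo_subset_Ioc_self (hK (support_deriv_subset h)))
  have hac := hfac α hα β hβ
  have hcont : ContinuousOn f (Icc α β) := by
    have := hac.continuousOn
    rwa [uIcc_of_le hαβ.le] at this
  have hfe : IntervalIntegrable (fun x => deriv f x ^ 2 * Real.exp (potential a b o x))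
      volume α β := by
    rw [intervalIntegrable_iff_integrableOn_Ioc_of_le hαβ.le]
    have h0 : ∀ x, 0 ≤ deriv f x ^ 2 * Real.exp (potential a b o x) := fun x => by positivity
    refine IntegrableOn.mono_set (t := openIvl (-M) N) ?_ (Ioc_subset_Icc_self.trans hsub)
    refine ⟨?_, ?_⟩
    · exact ((measurable_deriv f).pow_const 2).aestronglyMeasurable.mul
        (hec.aestronglyMeasurable (measurableSet_openIvl _ _))
    · rw [hasFiniteIntegral_iff_ofReal (Filter.Eventually.of_forall h0)]
      exact lt_top_iff_ne_top.2 hD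
  have hE := energy_eq_ofReal_integral hα hβ hαβ.le hf0' hfe
  have hnorm := eLpNorm_two_sq_withDensity hUc hm (fun x hx => (hm0 x hx).le) hα hβ hαβ.le
    hcont (fun x hx => hf0 x fun h => hx (Ioo_subset_Ioc_self h))
  have hnorm1 : ∫ x in α..β, f x ^ 2 * (Real.exp (potential a b o x) / a x) = 1 := by
    change eLpNorm f 2 (speedMeasure M N a b o) ^ 2 = _ at hnorm
    rw [hf1, one_pow] at hnorm
    exact (ENNReal.ofReal_eq_one.1 hnorm.symm)
  have hF0 := fun x hx => withDensity_openIvl_left_ne_zero (x := x) hσl hσ0 hx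
  have hG0 := fun x hx => withDensity_openIvl_right_ne_zero (x := x) hσl hσ0 hx
  have hmi : ∀ x ∈ openIvl (-M) N, ∀ y ∈ openIvl (-M) N,
      IntervalIntegrable (fun x => Real.exp (potential a b o x) / a x) volume x y :=
    fun x hx y hy => intervalIntegrable_of_locallyIntegrableOn hUc hm hx hy
  have key := integral_sq_mul_le_four_mul hU hUc
    (σ := fun x => Real.exp (-potential a b o x)) (e := fun x => Real.exp (potential a b o x))
    (ρ := fun x => J.toReal * (Real.exp (potential a b o x) / a x))
    (F := fun x => scaleMeasure M N a b o (openIvl (-M) x))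
    (G := fun x => scaleMeasure M N a b o (openIvl x N))
    hσc hσ0 (fun x _ => by rw [← Real.exp_add]; simp)
    (fun x hx => mul_nonneg ENNReal.toReal_nonneg (hm0 x hx).le) hF0 hG0
    (fun x hx y hy hxy => withDensity_openIvl_left hσl (fun t ht => (hσ0 t ht).le) hx hy hxy)
    (fun x hx y hy hxy => withDensity_openIvl_right hσl (fun t ht => (hσ0 t ht).le) hx hy hxy)
    hα hβ hαβ
    (fun x hx y hy hxy => by
      have h1 := hJ x hx y hy hxy
      have hpos := integral_pos_of_locallyIntegrableOn hUc hm hm0 hx hy hxy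
      have h2 : speedMeasure M N a b o (openIvl x y) =
          ENNReal.ofReal (∫ t in x..y, Real.exp (potential a b o t) / a t) := by
        rw [openIvl_coe]
        exact withDensity_restrict_Ioo hUc hm (fun t ht => (hm0 t ht).le) hx hy hxy.le
      -- `μ(x, y)` is positive and finite, so the division can be cleared: `J μ(x, y) ≤ 1/F x + 1/G
      -- y`.
      rw [← div_eq_mul_inv, ENNReal.le_div_iff_mul_le (Or.inl (by simp [h2, hpos]))
        (Or.inl (by simp [h2])), h2] at h1
      have hFt : (scaleMeasure M N a b o (openIvl (-M) x))⁻¹ ≠ ⊤ := ENNReal.inv_ne_top.2 (hF0 x hx)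
      have hGt : (scaleMeasure M N a b o (openIvl y N))⁻¹ ≠ ⊤ := ENNReal.inv_ne_top.2 (hG0 y hy)
      have h3 := ENNReal.toReal_mono (ENNReal.add_ne_top.2 ⟨hFt, hGt⟩) h1
      rw [ENNReal.toReal_mul, ENNReal.toReal_ofReal hpos.le, ENNReal.toReal_add hFt hGt] at h3
      rwa [intervalIntegral.integral_const_mul])
    (fun x hx y hy => (hmi x hx y hy).const_mul _)
    hac (hf0 α (by simp)) (hf0 β (by simp)) hfe
  have h4 : ∫ x in α..β, f x ^ 2 * (J.toReal * (Real.exp (potential a b o x) / a x)) =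
      J.toReal := by
    simp only [mul_left_comm _ J.toReal, intervalIntegral.integral_const_mul, hnorm1, mul_one]
  rw [h4] at key
  rw [hE, ← ENNReal.ofReal_toReal hJt]
  calc ENNReal.ofReal J.toReal ≤ ENNReal.ofReal (4 * _) := ENNReal.ofReal_le_ofReal key
    _ = _ := by rw [ENNReal.ofReal_mul (by norm_num)]; norm_num

end Bounds

/-! ### Upper bound for the eigenvalue: trial functions and exhaustion. -/

/-- Continuity from below along real endpoints decreasing to `l`, which may be `-∞`; trial functions
need endpoints inside `E`. -/
lemma exists_seq_tendsto_measure_Ioo_left (ν : Measure ℝ) {l : EReal} {x : ℝ}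
    (hx : l < (x : EReal)) : ∃ u : ℕ → ℝ, (∀ n, l < (u n : EReal) ∧ u n < x) ∧
      Filter.Tendsto (fun n => ν (Ioo (u n) x)) Filter.atTop (nhds (ν (openIvl l x))) := by
  obtain ⟨v, hv, hmem, hlim⟩ := exists_seq_strictAnti_tendsto' hx
  have hcoe : ∀ n, ((v n).toReal : EReal) = v n := fun n =>
    EReal.coe_toReal (ne_top_of_lt (hmem n).2) (ne_bot_of_gt (hmem n).1)
  refine ⟨fun n => (v n).toReal, fun n => ⟨by rw [hcoe]; exact (hmem n).1, ?_⟩, ?_⟩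
  · rw [← EReal.coe_lt_coe_iff, hcoe]; exact (hmem n).2
  · have h1 : openIvl l x = ⋃ n, Ioo (v n).toReal x := by
      ext z
      simp only [openIvl, mem_ofPred_eq, mem_iUnion, mem_Ioo, EReal.coe_lt_coe_iff]
      constructor
      · rintro ⟨hz, hzx⟩
        obtain ⟨n, hn⟩ := (hlim.eventually_lt_const hz).exists
        exact ⟨n, by rwa [← EReal.coe_lt_coe_iff, hcoe], hzx⟩
      · rintro ⟨n, hz, hzx⟩
        rw [← EReal.coe_lt_coe_iff, hcoe] at hz
        exact ⟨(hmem n).1.trans hz, hzx⟩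
    rw [h1]
    refine tendsto_measure_iUnion_atTop fun m n hmn => Ioo_subset_Ioo_left ?_
    rw [← EReal.coe_le_coe_iff, hcoe, hcoe]
    exact hv.antitone hmn

lemma exists_seq_tendsto_measure_Ioo_right (ν : Measure ℝ) {r : EReal} {x : ℝ}
    (hx : (x : EReal) < r) : ∃ u : ℕ → ℝ, (∀ n, x < u n ∧ (u n : EReal) < r) ∧
      Filter.Tendsto (fun n => ν (Ioo x (u n))) Filter.atTop (nhds (ν (openIvl x r))) := by
  obtain ⟨v, hv, hmem, hlim⟩ := exists_seq_strictMono_tendsto' hx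
  have hcoe : ∀ n, ((v n).toReal : EReal) = v n := fun n =>
    EReal.coe_toReal (ne_top_of_lt (hmem n).2) (ne_bot_of_gt (hmem n).1)
  refine ⟨fun n => (v n).toReal, fun n => ⟨?_, by rw [hcoe]; exact (hmem n).2⟩, ?_⟩
  · rw [← EReal.coe_lt_coe_iff, hcoe]; exact (hmem n).1
  · have h1 : openIvl x r = ⋃ n, Ioo x (v n).toReal := by
      ext z
      simp only [openIvl, mem_ofPred_eq, mem_iUnion, mem_Ioo, EReal.coe_lt_coe_iff]
      constructor
      · rintro ⟨hzx, hz⟩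
        obtain ⟨n, hn⟩ := (hlim.eventually_const_lt hz).exists
        exact ⟨n, hzx, by rwa [← EReal.coe_lt_coe_iff, hcoe]⟩
      · rintro ⟨n, hzx, hz⟩
        rw [← EReal.coe_lt_coe_iff, hcoe] at hz
        exact ⟨hzx, hz.trans (hmem n).2⟩
    rw [h1]
    refine tendsto_measure_iUnion_atTop fun m n hmn => Ioo_subset_Ioo_right ?_
    rw [← EReal.coe_le_coe_iff, hcoe, hcoe]
    exact hv.monotone hmn

section Bounds

variable {M N : EReal} {a b : ℝ → ℝ} {o : ℝ}

lemma const_mul_mem_testFunctions {f : ℝ → ℝ} (hf : f ∈ testFunctions M N) (k : ℝ) :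
    (fun x => k * f x) ∈ testFunctions M N :=
  ⟨fun s hs t ht => (hf.1 s hs t ht).const_mul k, hf.2.1.mul_left,
    (tsupport_mul_subset_right (f := fun _ => k)).trans hf.2.2⟩

lemma energy_const_mul (f : ℝ → ℝ) (k : ℝ) :
    energy M N a b o (fun x => k * f x) = ENNReal.ofReal (k ^ 2) * energy M N a b o f := by
  rw [energy, energy, ← lintegral_const_mul' _ _ ENNReal.ofReal_ne_top]
  refine lintegral_congr fun x => ?_
  rw [← ENNReal.ofReal_mul (sq_nonneg k), deriv_const_mul_field, mul_pow, mul_assoc]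

/-- Energy and squared norm are both homogeneous of degree two, so the normalisation may be traded
for a Rayleigh quotient. -/
lemma lambdaDD_le_energy_mul_inv {f : ℝ → ℝ} (hf : f ∈ testFunctions M N)
    (h0 : eLpNorm f 2 (speedMeasure M N a b o) ≠ 0)
    (htop : eLpNorm f 2 (speedMeasure M N a b o) ≠ ⊤) :
    lambdaDD M N a b o ≤
      energy M N a b o f * (eLpNorm f 2 (speedMeasure M N a b o) ^ 2)⁻¹ := by
  set n := eLpNorm f 2 (speedMeasure M N a b o) with hn
  have hpos : 0 < n.toReal := ENNReal.toReal_pos h0 htop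
  have h1 : eLpNorm (fun x => n.toReal⁻¹ * f x) 2 (speedMeasure M N a b o) = 1 := by
    have := eLpNorm_const_smul n.toReal⁻¹ f 2 (speedMeasure M N a b o)
    change eLpNorm (fun x => n.toReal⁻¹ * f x) 2 _ = _ at this
    rw [this, ← hn, Real.enorm_eq_ofReal (inv_nonneg.2 hpos.le), ENNReal.ofReal_inv_of_pos hpos,
      ENNReal.ofReal_toReal htop, ENNReal.inv_mul_cancel h0 htop]
  refine (iInf₂_le _ ⟨const_mul_mem_testFunctions hf n.toReal⁻¹, h1⟩).trans (le_of_eq ?_)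
  rw [energy_const_mul, mul_comm, inv_pow, ENNReal.ofReal_inv_of_pos (by positivity),
    ENNReal.ofReal_pow hpos.le, ENNReal.ofReal_toReal htop]

/-- The trial function climbs as `ν(x₀, t) / ν(x₀, x)`, stays at `1` on `[x, y]`, and descends
likewise. By Cauchy–Schwarz such slopes are the cheapest in energy. -/
lemma lambdaDD_le_of_compact_ends (ho : o ∈ openIvl (-M) N)
    (ha : ∀ x ∈ openIvl (-M) N, 0 < a x)
    (hb : LocallyIntegrableOn (fun x => b x / a x) (openIvl (-M) N) volume)
    (hm : LocallyIntegrableOn (fun x => Real.exp (potential a b o x) / a x)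
      (openIvl (-M) N) volume) {x₀ x y y₀ : ℝ} (hx₀ : x₀ ∈ openIvl (-M) N)
    (hy₀ : y₀ ∈ openIvl (-M) N) (h1 : x₀ < x) (h2 : x < y) (h3 : y < y₀) :
    lambdaDD M N a b o ≤
      ((scaleMeasure M N a b o (Ioo x₀ x))⁻¹ + (scaleMeasure M N a b o (Ioo y y₀))⁻¹) *
        (speedMeasure M N a b o (openIvl x y))⁻¹ := by
  have hUc := ordConnected_openIvl (-M) N
  have hU := measurableSet_openIvl (-M) N
  have hsub : Icc x₀ y₀ ⊆ openIvl (-M) N := hUc.out hx₀ hy₀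
  have hx : x ∈ openIvl (-M) N := hsub ⟨h1.le, (h2.trans h3).le⟩
  have hy : y ∈ openIvl (-M) N := hsub ⟨(h1.trans h2).le, h3.le⟩
  have hσc := continuousOn_exp_neg_potential ho hb
  set σ : ℝ → ℝ := fun x => Real.exp (-potential a b o x) with hσ
  have hσl : LocallyIntegrableOn σ (openIvl (-M) N) volume := hσc.locallyIntegrableOn hU
  have hσ0 : ∀ x ∈ openIvl (-M) N, 0 < σ x := fun x _ => Real.exp_pos _
  have hm0 : ∀ x ∈ openIvl (-M) N, 0 < Real.exp (potential a b o x) / a x :=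
    fun x hx => div_pos (Real.exp_pos _) (ha x hx)
  set A := ∫ t in x₀..x, σ t with hA
  set B := ∫ t in y..y₀, σ t with hB
  have hApos : 0 < A := integral_pos_of_locallyIntegrableOn hUc hσl hσ0 hx₀ hx h1
  have hBpos : 0 < B := integral_pos_of_locallyIntegrableOn hUc hσl hσ0 hy hy₀ h3
  have hνA : scaleMeasure M N a b o (Ioo x₀ x) = ENNReal.ofReal A :=
    withDensity_restrict_Ioo hUc hσl (fun t ht => (hσ0 t ht).le) hx₀ hx h1.le
  have hνB : scaleMeasure M N a b o (Ioo y y₀) = ENNReal.ofReal B :=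
    withDensity_restrict_Ioo hUc hσl (fun t ht => (hσ0 t ht).le) hy hy₀ h3.le
  -- the derivative of the test function
  set g : ℝ → ℝ := fun t => (Ioc x₀ x).indicator (fun t => σ t * A⁻¹) t -
    (Ioc y y₀).indicator (fun t => σ t * B⁻¹) t with hg
  have gl : ∀ t ∈ Ioc x₀ x, g t = σ t * A⁻¹ := fun t ht => by
    have : t ∉ Ioc y y₀ := fun h => absurd (h.1.trans_le ht.2) (not_lt.2 h2.le)
    simp [hg, ht, this]
  have gr : ∀ t ∈ Ioc y y₀, g t = -(σ t * B⁻¹) := fun t ht => by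
    have : t ∉ Ioc x₀ x := fun h => absurd (ht.1.trans_le h.2) (not_lt.2 h2.le)
    simp [hg, ht, this]
  have g0 : ∀ t, t ∉ Ioc x₀ x → t ∉ Ioc y y₀ → g t = 0 := fun t h h' => by simp [hg, h, h']
  have hgi : Integrable g := by
    refine Integrable.sub ?_ ?_
    · refine IntegrableOn.integrable_indicator (Integrable.mul_const ?_ _) measurableSet_Ioc
      exact (intervalIntegrable_iff_integrableOn_Ioc_of_le h1.le).1
        (intervalIntegrable_of_locallyIntegrableOn hUc hσl hx₀ hx)
    · refine IntegrableOn.integrable_indicator (Integrable.mul_const ?_ _) measurableSet_Ioc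
      exact (intervalIntegrable_iff_integrableOn_Ioc_of_le h3.le).1
        (intervalIntegrable_of_locallyIntegrableOn hUc hσl hy hy₀)
  have hgii : ∀ s t, IntervalIntegrable g volume s t := fun s t => hgi.intervalIntegrable
  set f : ℝ → ℝ := fun t => ∫ u in x₀..t, g u with hf
  have fadd : ∀ s t, f t = f s + ∫ u in s..t, g u := fun s t =>
    (intervalIntegral.integral_add_adjacent_intervals (hgii x₀ s) (hgii s t)).symm
  have fzero : ∀ s t, s ≤ t → (∀ u ∈ Ioc s t, g u = 0) → f t = f s := by
    intro s t hst h
    rw [fadd s t, intervalIntegral.integral_of_le hst, setIntegral_congr_fun measurableSet_Ioc h]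
    simp
  have fx₀ : f x₀ = 0 := by simp [hf]
  have fl : ∀ t ≤ x₀, f t = 0 := fun t ht => by
    rw [← fzero t x₀ ht fun u hu => g0 u (fun h => absurd h.1 (not_lt.2 hu.2))
      (fun h => absurd (((h1.trans h2).trans h.1).trans_le hu.2) (lt_irrefl _)), fx₀]
  have fx : f x = 1 := by
    rw [fadd x₀ x, fx₀, intervalIntegral.integral_of_le h1.le,
      setIntegral_congr_fun measurableSet_Ioc gl, ← intervalIntegral.integral_of_le h1.le,
      intervalIntegral.integral_mul_const, mul_inv_cancel₀ hApos.ne', zero_add]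
  have fm : ∀ t ∈ Icc x y, f t = 1 := fun t ht => by
    rw [fzero x t ht.1 fun u hu => g0 u (fun h => absurd h.2 (not_le.2 hu.1))
      (fun h => absurd (h.1.trans_le (hu.2.trans ht.2)) (lt_irrefl _)), fx]
  have fy₀ : f y₀ = 0 := by
    rw [fadd y y₀, fm y ⟨h2.le, le_rfl⟩, intervalIntegral.integral_of_le h3.le,
      setIntegral_congr_fun measurableSet_Ioc gr, ← intervalIntegral.integral_of_le h3.le,
      intervalIntegral.integral_neg, intervalIntegral.integral_mul_const,
      mul_inv_cancel₀ hBpos.ne', add_neg_cancel]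
  have fr : ∀ t, y₀ ≤ t → f t = 0 := fun t ht => by
    rw [fzero y₀ t ht fun u hu => g0 u (fun h => absurd (h.2.trans (h2.trans h3).le)
      (not_le.2 hu.1)) (fun h => absurd h.2 (not_le.2 hu.1)), fy₀]
  have hsupp : tsupport f ⊆ Icc x₀ y₀ := by
    refine closure_minimal (fun t ht => ?_) isClosed_Icc
    by_contra h
    rcases not_and_or.1 h with h | h
    · exact ht (fl t (not_le.1 h).le)
    · exact ht (fr t (not_le.1 h).le)
  have hac : ∀ s t, AbsolutelyContinuousOnInterval f s t := by
    intro s t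
    have h : AbsolutelyContinuousOnInterval f (min x₀ (min s t)) (max x₀ (max s t)) :=
      (hgii _ _).absolutelyContinuousOnInterval_intervalIntegral
        (by rw [uIcc_of_le (by simp)]; simp)
    refine h.mono ?_
    rw [uIcc_of_le (a := min x₀ (min s t)) (by simp)]
    exact uIcc_subset_Icc ⟨by simp, by simp⟩ ⟨by simp, by simp⟩
  have hft : f ∈ testFunctions M N :=
    ⟨fun s _ t _ => hac s t, HasCompactSupport.intro isCompact_Icc fun t ht => by
      by_contra h
      exact ht (hsupp (subset_tsupport f h)), hsupp.trans hsub⟩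
  -- its energy
  have hE : energy M N a b o f = ENNReal.ofReal A⁻¹ + ENNReal.ofReal B⁻¹ := by
    have hpiece : ∀ s t k : ℝ, s ∈ openIvl (-M) N → t ∈ openIvl (-M) N → s ≤ t →
        ∫ u in s..t, σ u = k → 0 < k →
        ∫⁻ u in openIvl (-M) N, (Ioc s t).indicator (fun u => ENNReal.ofReal (σ u * (k ^ 2)⁻¹)) u =
          ENNReal.ofReal k⁻¹ := by
      intro s t k hs ht hst hk hk0
      have hi := (intervalIntegrable_of_locallyIntegrableOn hUc hσl hs ht).mul_const (k ^ 2)⁻¹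
      rw [setLIntegral_indicator measurableSet_Ioc,
        inter_eq_left.2 (Ioc_subset_Icc_self.trans (hUc.out hs ht)),
        ← ofReal_integral_eq_lintegral_ofReal
          ((intervalIntegrable_iff_integrableOn_Ioc_of_le hst).1 hi)
          (Filter.Eventually.of_forall fun u => by positivity),
        ← intervalIntegral.integral_of_le hst, intervalIntegral.integral_mul_const, hk]
      congr 1
      field_simp
    rw [← hpiece x₀ x A hx₀ hx h1.le rfl hApos, ← hpiece y y₀ B hy hy₀ h3.le rfl hBpos,
      ← lintegral_add_left', energy]
    · refine lintegral_congr_ae (ae_restrict_of_ae ?_)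
      -- By Lebesgue differentiation `f' = g` almost everywhere; then `σ e^C = 1` reduces `g² e^C`
      -- to `σ / A²` and `σ / B²` on the two slopes.
      have hd := LocallyIntegrable.ae_hasDerivAt_integral hgi.locallyIntegrable
      filter_upwards [hd] with t ht
      have hσe : σ t * Real.exp (potential a b o t) = 1 := by
        rw [hσ, ← Real.exp_add]; simp
      rw [(ht x₀).deriv]
      by_cases hl : t ∈ Ioc x₀ x
      · have : t ∉ Ioc y y₀ := fun h => absurd (h.1.trans_le hl.2) (not_lt.2 h2.le)
        simp only [indicator_of_mem hl, indicator_of_notMem this, add_zero, gl t hl]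
        congr 1
        linear_combination σ t * A⁻¹ ^ 2 * hσe
      · by_cases hr : t ∈ Ioc y y₀
        · simp only [indicator_of_mem hr, indicator_of_notMem hl, zero_add, gr t hr]
          congr 1
          linear_combination σ t * B⁻¹ ^ 2 * hσe
        · simp [hl, hr, g0 t hl hr]
    · refine AEMeasurable.indicator ?_ measurableSet_Ioc
      exact ((hσc.aemeasurable hU).mul_const _).ennreal_ofReal
  -- its norm
  have hle : x₀ ≤ y₀ := ((h1.trans h2).trans h3).le
  have hfcont : ContinuousOn f (Icc x₀ y₀) := by
    rw [← uIcc_of_le hle]; exact (hac x₀ y₀).continuousOn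
  have hnorm : eLpNorm f 2 (speedMeasure M N a b o) ^ 2 =
      ENNReal.ofReal (∫ t in x₀..y₀, f t ^ 2 * (Real.exp (potential a b o t) / a t)) :=
    eLpNorm_two_sq_withDensity hUc hm (fun t ht => (hm0 t ht).le) hx₀ hy₀ hle hfcont
      (fun t ht => by
        rcases not_and_or.1 ht with h | h
        · exact fl t (not_lt.1 h)
        · exact fr t (not_le.1 h).le)
  have hμ : speedMeasure M N a b o (openIvl x y) =
      ENNReal.ofReal (∫ t in x..y, Real.exp (potential a b o t) / a t) := by
    rw [openIvl_coe]
    exact withDensity_restrict_Ioo hUc hm (fun t ht => (hm0 t ht).le) hx hy h2.le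
  have hμpos := integral_pos_of_locallyIntegrableOn hUc hm hm0 hx hy h2
  have hnle : speedMeasure M N a b o (openIvl x y) ≤
      eLpNorm f 2 (speedMeasure M N a b o) ^ 2 := by
    rw [hμ, hnorm]
    refine ENNReal.ofReal_le_ofReal ?_
    have e1 : ∫ t in x..y, Real.exp (potential a b o t) / a t =
        ∫ t in x..y, f t ^ 2 * (Real.exp (potential a b o t) / a t) := by
      refine intervalIntegral.integral_congr fun t ht => ?_
      rw [uIcc_of_le h2.le] at ht
      simp [fm t ht]
    rw [e1]
    refine intervalIntegral.integral_mono_interval h1.le h2.le h3.le ?_ ?_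
    · refine (ae_restrict_iff' measurableSet_Ioc).2 (Filter.Eventually.of_forall fun t ht => ?_)
      exact mul_nonneg (sq_nonneg _) (hm0 t (hsub (Ioc_subset_Icc_self ht))).le
    · exact (intervalIntegrable_of_locallyIntegrableOn hUc hm hx₀ hy₀).continuousOn_mul
        (by rw [uIcc_of_le hle]; exact hfcont.pow 2)
  have hn0 : eLpNorm f 2 (speedMeasure M N a b o) ≠ 0 := by
    intro h
    rw [h, hμ] at hnle
    simp at hnle
    linarith
  have hnt : eLpNorm f 2 (speedMeasure M N a b o) ≠ ⊤ := by
    intro h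
    rw [h] at hnorm
    simp at hnorm
  refine (lambdaDD_le_energy_mul_inv hft hn0 hnt).trans ?_
  rw [hE, hνA, hνB, ENNReal.ofReal_inv_of_pos hApos, ENNReal.ofReal_inv_of_pos hBpos]
  gcongr

lemma lambdaDD_le (ho : o ∈ openIvl (-M) N)
    (ha : ∀ x ∈ openIvl (-M) N, 0 < a x)
    (hb : LocallyIntegrableOn (fun x => b x / a x) (openIvl (-M) N) volume)
    (hm : LocallyIntegrableOn (fun x => Real.exp (potential a b o x) / a x)
      (openIvl (-M) N) volume) {x y : ℝ} (hx : x ∈ openIvl (-M) N)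
    (hy : y ∈ openIvl (-M) N) (hxy : x < y) :
    lambdaDD M N a b o ≤
      ((scaleMeasure M N a b o (openIvl (-M) x))⁻¹ + (scaleMeasure M N a b o (openIvl y N))⁻¹) *
        (speedMeasure M N a b o (openIvl x y))⁻¹ := by
  -- Makes `1 / μ(x, y)` finite, so multiplication by it stays continuous even if the sum of
  -- inverses tends to `0`, as when both ends have infinite `ν`-mass.
  have hμ : speedMeasure M N a b o (openIvl x y) ≠ 0 := by
    have hm0 : ∀ x ∈ openIvl (-M) N, 0 < Real.exp (potential a b o x) / a x :=
      fun x hx => div_pos (Real.exp_pos _) (ha x hx)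
    have hUc := ordConnected_openIvl (-M) N
    rw [openIvl_coe, speedMeasure,
      withDensity_restrict_Ioo hUc hm (fun t ht => (hm0 t ht).le) hx hy hxy.le]
    simpa using integral_pos_of_locallyIntegrableOn hUc hm hm0 hx hy hxy
  obtain ⟨u, hu, hul⟩ := exists_seq_tendsto_measure_Ioo_left (scaleMeasure M N a b o) hx.1
  obtain ⟨v, hv, hvl⟩ := exists_seq_tendsto_measure_Ioo_right (scaleMeasure M N a b o) hy.2
  have hlim := ENNReal.Tendsto.mul_const (b := (speedMeasure M N a b o (openIvl x y))⁻¹)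
    ((tendsto_inv_iff.2 hul).add (tendsto_inv_iff.2 hvl))
    (Or.inr (ENNReal.inv_ne_top.2 hμ))
  refine ge_of_tendsto' hlim fun n => ?_
  exact lambdaDD_le_of_compact_ends ho ha hb hm
    ⟨(hu n).1, (EReal.coe_lt_coe_iff.2 (hu n).2).trans hx.2⟩
    ⟨hy.1.trans (EReal.coe_lt_coe_iff.2 (hv n).1), (hv n).2⟩ (hu n).2 hxy (hv n).1

end Bounds

end DiffusionDD

/-! ### The two bounds combined. -/

theorem mainTheorem3 (M N : EReal) (a b : ℝ → ℝ) (o : ℝ)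
    (ho : o ∈ DiffusionDD.openIvl (-M) N)
    (ha : ∀ x ∈ DiffusionDD.openIvl (-M) N, 0 < a x)
    (hb : LocallyIntegrableOn (fun x => b x / a x) (DiffusionDD.openIvl (-M) N) volume)
    (hm : LocallyIntegrableOn (fun x => Real.exp (DiffusionDD.potential a b o x) / a x)
      (DiffusionDD.openIvl (-M) N) volume) :
    (4 * DiffusionDD.kappaDD M N a b o)⁻¹ ≤ DiffusionDD.lambdaDD M N a b o ∧
      DiffusionDD.lambdaDD M N a b o ≤ (DiffusionDD.kappaDD M N a b o)⁻¹ := by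
  rw [ENNReal.mul_inv (Or.inl (by norm_num)) (Or.inl (by norm_num)), DiffusionDD.kappaDD, inv_inv]
  constructor
  · refine le_iInf₂ fun f hf => ?_
    rw [ENNReal.inv_mul_le_iff (by norm_num) (by norm_num)]
    -- The Hardy argument uses a finite `J`; finite values below the infimum suffice, so its
    -- finiteness need not be shown.
    refine ENNReal.le_of_forall_nnreal_lt fun r hr => ?_
    refine DiffusionDD.le_four_mul_energy ho ha hb hm hf.1 hf.2 ENNReal.coe_ne_top ?_
    intro x hx y hy hxy
    exact hr.le.trans ((iInf₂_le x hx).trans ((iInf₂_le y hy).trans (iInf_le _ hxy)))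
  · exact le_iInf₂ fun x hx => le_iInf₂ fun y hy => le_iInf fun hxy =>
      DiffusionDD.lambdaDD_le ho ha hb hm hx hy hxy
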